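/- Let $X$ be a real Banach space with dual $X^*$. For $T:X\rightrightarrows X^*$ put $G(T)=\{(x,x^*):x^*\in T(x)\}$ and $D_T=\{x:T(x)\neq\emptyset\}$. $T$ is monotone if $\langle x^*-y^*,x-y\rangle\ge 0$ for all $(x,x^*),(y,y^*)\in G(T)$, and maximal monotone if moreover no monotone operator has a graph strictly containing $G(T)$. $T$ is bounded if its range $\bigcup_x T(x)$ is a norm-bounded subset of $X^*$. Sums of operators are pointwise, $(T+S)(x)=\{a+b: a\in T(x),\ b\in S(x)\}$. For $f:X\to\mathbb R$, $\partial f(y)=\{u\in X^*: f(y)+\langle u,z-y\rangle\le f(z)\ \text{for all } z\in X\}$. For $\lambda>0$ and $x\in X$ let $g_{\lambda,x}(y)=\lambda\|x-y\|$. Let $$L(x,x^*,T)=\sup\left(\{0\}\cup\left\{\frac{\langle y^*-x^*,x-y\rangle}{\|x-y\|}: (y,y^*)\in G(T),\ y\ne x\right\}\right)\in[0,\infty],$$ and let $d(x^*,A)=\inf_{a^*\in A}\|a^*-x^*\|$, with $d(x^*,\emptyset)=\infty$. **Theorem 2.3.** Let $T:X\rightrightarrows X^*$ be a maximal monotone operator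 on a real Banach space $X$. The following are equivalent: (a) $L(x,x^*,T)=d(x^*,T(x))$ for all $(x,x^*)\in X\times X^*$ (that is, $T$ is regular); (b) for every bounded maximal monotone operator $S:X\rightrightarrows X^*$, $T+S$ is maximal monotone; (c) $T+\partial g_{\lambda,x}$ is maximal monotone for all $\lambda>0$ and $x\in X$; (d) for every $x\in X$, if $L(x,0^*,T)<\infty$ then $x\in D_T$; (e) $L(x,0^*,T)=d(0^*,T(x))$ for all $x\in X$. -/

import Mathlib

open scoped Pointwise ENNReal

namespace RegularMonotone

variable {X : Type*} [NormedAddCommGroup X] [NormedSpace ℝ X]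

/-- The graph of a multivalued operator from `X` to its topological dual. -/
def graph (T : X → Set (StrongDual ℝ X)) : Set (X × StrongDual ℝ X) :=
  {p | p.2 ∈ T p.1}

/-- The domain of a multivalued operator: the points with a nonempty image. -/
def domain (T : X → Set (StrongDual ℝ X)) : Set X :=
  {x | (T x).Nonempty}

/-- The range of a multivalued operator. -/
def range (T : X → Set (StrongDual ℝ X)) : Set (StrongDual ℝ X) :=
  {u | ∃ x, u ∈ T x}

/-- The pointwise (Minkowski) sum of two multivalued operators; its domain is the intersection
of the two domains. -/
def opAdd (T S : X → Set (StrongDual ℝ X)) : X → Set (StrongDual ℝ X) :=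
  fun x => T x + S x

/-- Monotonicity of a multivalued operator. -/
def IsMonotone (T : X → Set (StrongDual ℝ X)) : Prop :=
  ∀ p ∈ graph T, ∀ q ∈ graph T, 0 ≤ (p.2 - q.2) (p.1 - q.1)

/-- Maximal monotonicity: no monotone operator has a strictly larger graph. -/
def IsMaximalMonotone (T : X → Set (StrongDual ℝ X)) : Prop :=
  IsMonotone T ∧ ¬ ∃ S : X → Set (StrongDual ℝ X), IsMonotone S ∧ graph T ⊂ graph S

/-- A bounded operator: the range is a norm-bounded subset of the dual. -/
def IsBoundedOp (T : X → Set (StrongDual ℝ X)) : Prop :=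
  Bornology.IsBounded (range T)

/-- The subdifferential (in the sense of convex analysis) of a real-valued function. -/
def subdifferential (f : X → ℝ) : X → Set (StrongDual ℝ X) :=
  fun y => {u | ∀ z, f y + u (z - y) ≤ f z}

/-- The function `g_{c,x}(y) = c * ‖x - y‖`. -/
def normFun (c : ℝ) (x : X) : X → ℝ :=
  fun y => c * ‖x - y‖

/-- `L(x, x*, T)`: the supremum of `⟨y* - x*, x - y⟩ / ‖x - y‖` over the `(y, y*)` in the graph of
`T` with `y ≠ x`. The supremum is taken in `[0, ∞]`: negative quotients count as `0`, and the
supremum of the empty family is `0`. -/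
noncomputable def slopeSup (x : X) (u : StrongDual ℝ X) (T : X → Set (StrongDual ℝ X)) : ℝ≥0∞ :=
  ⨆ p : X × StrongDual ℝ X, ⨆ _ : p ∈ graph T, ⨆ _ : p.1 ≠ x,
    ENNReal.ofReal ((p.2 - u) (x - p.1) / ‖x - p.1‖)

end RegularMonotone

namespace RegularMonotone

section Aux

variable {X : Type*} [NormedAddCommGroup X] [NormedSpace ℝ X]

/-! The implications run (a) → (e) → (d) → (b) → (c) → (a), and (d) → (b) carries the weight. If
`(x, u)` is monotonically related to `T + S` with `S` bounded, then `slopeSup x 0 T` is finite, so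
(d) puts `x` in the domain of `T`. It remains to split `u = w + (u - w)` between `T x` and `S x`
(`opAdd_of_bounded`). The conditions on `w` form a convex system of affine inequalities, solved by
Hahn–Banach (`exists_norm_le_forall_apply_le`). For (c) → (a), a bound `c` on the slope makes `(x,
u)` monotonically related to `T + ∂g_{c,x}`, so `u` differs from an element of `T x` by a
subgradient of norm at most `c`. -/

/-- A pair monotonically related to a maximal monotone operator belongs to its graph. -/
theorem IsMaximalMonotone.mem_of_related {T : X → Set (StrongDual ℝ X)}
    (hT : IsMaximalMonotone T) {x : X} {u : StrongDual ℝ X}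
    (h : ∀ y, ∀ v ∈ T y, 0 ≤ (v - u) (y - x)) : u ∈ T x := by
  by_contra hu
  refine hT.2 ⟨fun y => {v | v ∈ T y ∨ (y = x ∧ v = u)}, ?_, ?_⟩
  · rintro ⟨y, v⟩ (hv | ⟨rfl, rfl⟩) ⟨z, w⟩ (hw | ⟨rfl, rfl⟩)
    · exact hT.1 (y, v) hv (z, w) hw
    · exact h y v hv
    · have := h z w hw
      simp only [sub_apply, map_sub] at this ⊢
      linarith
    · simp
  · refine ⟨fun p hp => Or.inl hp, fun hsub => hu ?_⟩
    exact hsub (show (x, u) ∈ graph _ from Or.inr ⟨rfl, rfl⟩)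

/-- A monotone operator containing every pair monotonically related to it is maximal. -/
theorem IsMonotone.isMaximalMonotone {T : X → Set (StrongDual ℝ X)} (hT : IsMonotone T)
    (h : ∀ x u, (∀ y, ∀ v ∈ T y, 0 ≤ (v - u) (y - x)) → u ∈ T x) : IsMaximalMonotone T := by
  refine ⟨hT, ?_⟩
  rintro ⟨S, hS, hTS, hST⟩
  refine hST ?_
  rintro ⟨x, u⟩ hu
  exact h x u fun y v hv => hS (y, v) (hTS hv) (x, u) hu

theorem IsMonotone.opAdd {T S : X → Set (StrongDual ℝ X)} (hT : IsMonotone T)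
    (hS : IsMonotone S) : IsMonotone (opAdd T S) := by
  rintro ⟨x, _⟩ ⟨a, ha, b, hb, rfl⟩ ⟨y, _⟩ ⟨c, hc, d, hd, rfl⟩
  have h₁ := hT (x, a) ha (y, c) hc
  have h₂ := hS (x, b) hb (y, d) hd
  simp only [sub_apply, add_apply, map_sub] at *
  linarith

/-! ### The subdifferential of a multiple of the distance to a point -/

theorem subdifferential_isMonotone (f : X → ℝ) : IsMonotone (subdifferential f) := by
  rintro ⟨x, u⟩ hu ⟨y, v⟩ hv
  have h₁ := hu y
  have h₂ := hv x
  simp only [sub_apply, map_sub] at *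
  linarith

theorem subdifferential_normFun_nonempty {c : ℝ} (hc : 0 ≤ c) (x y : X) :
    (subdifferential (normFun c x) y).Nonempty := by
  obtain ⟨g, hg, hgy⟩ := exists_dual_vector'' ℝ (y - x)
  have hgy' : g (y - x) = ‖y - x‖ := by simpa using hgy
  refine ⟨c • g, fun z => ?_⟩
  have h₁ : g (z - x) ≤ ‖z - x‖ := (le_abs_self _).trans (by
    simpa using g.le_of_opNorm_le hg (z - x))
  have h₂ : g (z - y) = g (z - x) - g (y - x) := by rw [← map_sub]; congr 1; abel
  simp only [normFun, norm_sub_rev x, smul_apply, smul_eq_mul, h₂, hgy']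
  nlinarith

theorem norm_le_of_mem_subdifferential_normFun {c : ℝ} (hc : 0 ≤ c) {x y : X}
    {u : StrongDual ℝ X} (hu : u ∈ subdifferential (normFun c x) y) : ‖u‖ ≤ c := by
  have key : ∀ z, u z ≤ c * ‖z‖ := fun z => by
    have h := hu (y + z)
    have h₂ : ‖x - (y + z)‖ ≤ ‖x - y‖ + ‖z‖ := by
      rw [← sub_sub]; exact norm_sub_le _ _
    simp only [normFun, add_sub_cancel_left] at h
    nlinarith [mul_le_mul_of_nonneg_left h₂ hc]
  refine u.opNorm_le_bound hc fun z => abs_le.2 ⟨?_, key z⟩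
  have := key (-z)
  rw [map_neg, norm_neg] at this
  linarith

theorem apply_of_mem_subdifferential_normFun {c : ℝ} {x y : X}
    {u : StrongDual ℝ X} (hu : u ∈ subdifferential (normFun c x) y) :
    c * ‖x - y‖ ≤ u (y - x) := by
  have h := hu x
  simp only [normFun, sub_self, norm_zero, mul_zero, map_sub] at h ⊢
  linarith

theorem subdifferential_normFun_isBoundedOp {c : ℝ} (hc : 0 ≤ c) (x : X) :
    IsBoundedOp (subdifferential (normFun c x)) := by
  refine isBounded_iff_forall_norm_le.2 ⟨c, ?_⟩
  rintro u ⟨y, hu⟩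
  exact norm_le_of_mem_subdifferential_normFun hc hu

/-- A subdifferential of a continuous function is maximal monotone as soon as it is
everywhere nonempty. -/
theorem subdifferential_isMaximalMonotone {f : X → ℝ} (hf : Continuous f)
    (hne : ∀ y, (subdifferential f y).Nonempty) : IsMaximalMonotone (subdifferential f) := by
  refine (subdifferential_isMonotone f).isMaximalMonotone fun y v hv z => ?_
  -- Minty's trick: monotonicity is tested on the segment from `y` to `z`, divided by `t`, and then
  -- `t → 0+`.
  have key : ∀ t : ℝ, t ∈ Set.Ioo (0 : ℝ) 1 →
      f (y + t • (z - y)) + v ((1 - t) • (z - y)) ≤ f z := by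
    intro t ht
    obtain ⟨u, hu⟩ := hne (y + t • (z - y))
    have h₁ := hv _ u hu
    have h₂ := hu z
    have h₃ : z - (y + t • (z - y)) = (1 - t) • (z - y) := by module
    rw [h₃] at h₂
    rw [add_sub_cancel_left, map_smul, sub_apply, smul_eq_mul] at h₁
    rw [map_smul, smul_eq_mul] at h₂ ⊢
    have h₄ : v (z - y) ≤ u (z - y) := by
      have := nonneg_of_mul_nonneg_right h₁ ht.1
      linarith
    nlinarith [ht.2]
  have hcont : Continuous fun t : ℝ => f (y + t • (z - y)) + v ((1 - t) • (z - y)) := by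
    fun_prop
  have hlim := (hcont.tendsto 0).mono_left (nhdsWithin_le_nhds (s := Set.Ioi 0))
  simp only [zero_smul, add_zero, sub_zero, one_smul] at hlim
  exact le_of_tendsto hlim (Filter.mem_of_superset (Ioo_mem_nhdsGT one_pos) key)

theorem subdifferential_normFun_isMaximalMonotone {c : ℝ} (hc : 0 ≤ c) (x : X) :
    IsMaximalMonotone (subdifferential (normFun c x)) :=
  subdifferential_isMaximalMonotone (by unfold normFun; fun_prop)
    (subdifferential_normFun_nonempty hc x)

/-! ### A theorem of the alternative -/

/-- A convex system of affine inequalities `w a ≤ c` has a solution `w` of norm at most `M` as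
soon as none of them is violated on the whole ball of radius `M`. -/
theorem exists_norm_le_forall_apply_le {C : Set (X × ℝ)} (hC : Convex ℝ C) {M : ℝ} (hM : 0 ≤ M)
    (h : ∀ p ∈ C, 0 ≤ p.2 + M * ‖p.1‖) :
    ∃ w : StrongDual ℝ X, ‖w‖ ≤ M ∧ ∀ p ∈ C, w p.1 ≤ p.2 := by
  rcases C.eq_empty_or_nonempty with rfl | ⟨p₀, hp₀⟩
  · exact ⟨0, by simpa using hM, by simp⟩
  -- An open convex cone disjoint from `C`. The solution is the slope of a hyperplane separating the
  -- two; that `U` lies on one side of it bounds the slope by `M`.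
  let U : Set (X × ℝ) := {p | p.2 + M * ‖p.1‖ < 0}
  have hUo : IsOpen U := isOpen_lt (by fun_prop) continuous_const
  have hUc : Convex ℝ U := by
    intro p hp q hq a b ha hb hab
    have hn : ‖a • p.1 + b • q.1‖ ≤ a * ‖p.1‖ + b * ‖q.1‖ := by
      refine (norm_add_le _ _).trans ?_
      rw [norm_smul, norm_smul, Real.norm_of_nonneg ha, Real.norm_of_nonneg hb]
    have hn' := mul_le_mul_of_nonneg_left hn hM
    simp only [U, Set.mem_ofPred_eq, Prod.fst_add, Prod.snd_add, Prod.smul_fst, Prod.smul_snd,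
      smul_eq_mul] at *
    rcases ha.eq_or_lt with rfl | ha'
    · have : b = 1 := by linarith
      subst this
      linarith
    · nlinarith [mul_neg_of_pos_of_neg ha' hp, mul_nonneg hb (neg_nonneg.2 hq.le)]
  obtain ⟨f, t, hfU, hfC⟩ := geometric_hahn_banach_open hUc hUo hC
    (Set.disjoint_left.2 fun p hp hpC => absurd (h p hpC) (not_le.2 hp))
  have hcone : ∀ p ∈ U, ∀ k : ℝ, 0 < k → k • p ∈ U := by
    intro p hp k hk
    have : (k • p).2 + M * ‖(k • p).1‖ = k * (p.2 + M * ‖p.1‖) := by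
      simp only [Prod.smul_fst, Prod.smul_snd, smul_eq_mul, norm_smul, Real.norm_of_nonneg hk.le]
      ring
    change (k • p).2 + M * ‖(k • p).1‖ < 0
    rw [this]
    exact mul_neg_of_pos_of_neg hk hp
  have hU0 : ∀ p ∈ U, f p ≤ 0 := by
    intro p hp
    by_contra! hpos
    have h₁ := hfU _ (hcone p hp ((|t| + 1) / f p) (by positivity))
    rw [map_smul, smul_eq_mul, div_mul_cancel₀ _ hpos.ne'] at h₁
    linarith [le_abs_self t]
  have hneg : ((0 : X), (-1 : ℝ)) ∈ U := by simp [U]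
  have ht : 0 ≤ t := by
    by_contra! htn
    have h₀ := hfU _ hneg
    have hf0 : f (0, -1) < 0 := h₀.trans htn
    have h₁ := hfU _ (hcone _ hneg (t / (2 * f (0, -1)))
      (div_pos_of_neg_of_neg htn (by linarith)))
    rw [map_smul, smul_eq_mul] at h₁
    have : t / (2 * f (0, -1)) * f (0, -1) = t / 2 := by
      have := hf0.ne
      field_simp
    linarith
  have hsplit : ∀ x r, f (x, r) = f (x, 0) + r * f (0, 1) := by
    intro x r
    have : ((x, r) : X × ℝ) = (x, 0) + r • (0, 1) := by simp
    rw [this, map_add, map_smul, smul_eq_mul]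
  have hclosed : ∀ x r, r + M * ‖x‖ ≤ 0 → f (x, r) ≤ 0 := by
    intro x r hr
    refine le_of_forall_pos_le_add fun ε hε => ?_
    have hτ : 0 ≤ f (0, 1) := by
      have := hU0 _ hneg
      rw [hsplit, ← Prod.zero_eq_mk, map_zero] at this
      linarith
    set τ := f (0, 1)
    have hδ : 0 < ε / (τ + 1) := by positivity
    have h₁ := hU0 (x, r - ε / (τ + 1)) (show r - ε / (τ + 1) + M * ‖x‖ < 0 by linarith)
    rw [hsplit] at h₁ ⊢
    have h₂ : ε / (τ + 1) * τ ≤ ε := by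
      rw [div_mul_eq_mul_div, div_le_iff₀ (by positivity)]
      nlinarith
    nlinarith
  -- The hyperplane is not vertical: otherwise `f ≤ 0` everywhere, while `f p₀ ≥ t > f (0, -1) = 0`.
  have hτ : 0 < f (0, 1) := by
    have h₁ := hU0 _ hneg
    rw [hsplit, ← Prod.zero_eq_mk, map_zero] at h₁
    refine lt_of_le_of_ne (by linarith) fun hτ0 => ?_
    have hz : ∀ x, f (x, 0) ≤ 0 := fun x => by
      have := hclosed x (-(M * ‖x‖)) (by linarith)
      rw [hsplit, ← hτ0] at this
      linarith
    have h₂ := hfU _ hneg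
    have h₃ := hfC p₀ hp₀
    rw [hsplit, ← Prod.zero_eq_mk, map_zero, ← hτ0] at h₂
    have h₄ : f p₀ = f (p₀.1, 0) := by
      have := hsplit p₀.1 p₀.2
      rw [← hτ0] at this
      simpa using this
    have h₅ := hz p₀.1
    linarith
  set τ := f (0, 1)
  let φ : StrongDual ℝ X := f.comp (ContinuousLinearMap.inl ℝ X ℝ)
  have hφ : ∀ x, φ x = f (x, 0) := fun x => by simp [φ]
  have hbound : ∀ x, φ x ≤ τ * (M * ‖x‖) := fun x => by
    have := hclosed x (-(M * ‖x‖)) (by linarith)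
    rw [hsplit] at this
    rw [hφ]
    linarith
  refine ⟨-(τ⁻¹ • φ), ?_, fun p hp => ?_⟩
  · rw [norm_neg]
    refine ContinuousLinearMap.opNorm_le_bound _ hM fun x => ?_
    rw [smul_apply, smul_eq_mul, Real.norm_eq_abs, abs_mul,
      abs_of_pos (inv_pos.2 hτ), inv_mul_le_iff₀ hτ, abs_le]
    refine ⟨?_, hbound x⟩
    have := hbound (-x)
    rw [map_neg, norm_neg] at this
    linarith
  · have h₁ := ht.trans (hfC p hp)
    rw [show p = (p.1, p.2) from rfl, hsplit, ← hφ] at h₁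
    rw [neg_apply, smul_apply, smul_eq_mul, neg_le,
      ← mul_le_mul_iff_of_pos_left hτ, mul_inv_cancel_left₀ hτ.ne']
    linarith

/-! ### The convex hull of the graph of the duality coupling -/

/-- The convex hull of the graph of the coupling `(y, u) ↦ u y` restricted to the graph
of `T`. -/
def couplingHull (T : X → Set (StrongDual ℝ X)) : Set (X × StrongDual ℝ X × ℝ) :=
  convexHull ℝ {q | q.2.1 ∈ T q.1 ∧ q.2.2 = q.2.1 q.1}

theorem mem_couplingHull {T : X → Set (StrongDual ℝ X)} {y : X} {u : StrongDual ℝ X}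
    (hu : u ∈ T y) : (y, u, u y) ∈ couplingHull T :=
  subset_convexHull ℝ _ ⟨hu, rfl⟩

theorem convex_couplingHull (T : X → Set (StrongDual ℝ X)) : Convex ℝ (couplingHull T) :=
  convex_convexHull ℝ _

theorem convex_setOf_pairing_le (y : X) (v : StrongDual ℝ X) (r : ℝ) :
    Convex ℝ {q : X × StrongDual ℝ X × ℝ | v q.1 + q.2.1 y ≤ q.2.2 + r} := by
  intro p hp q hq a b ha hb hab
  simp only [Set.mem_ofPred_eq, Prod.fst_add, Prod.snd_add, Prod.smul_fst, Prod.smul_snd, map_add,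
    map_smul, add_apply, smul_apply, smul_eq_mul] at *
  have h₁ := mul_le_mul_of_nonneg_left hp ha
  have h₂ := mul_le_mul_of_nonneg_left hq hb
  have h₃ : a * r + b * r = r := by rw [← add_mul, hab, one_mul]
  linarith

theorem IsMonotone.pairing_le {T : X → Set (StrongDual ℝ X)} (hT : IsMonotone T)
    {q : X × StrongDual ℝ X × ℝ} (hq : q ∈ couplingHull T) {y : X} {v : StrongDual ℝ X}
    (hv : v ∈ T y) : v q.1 + q.2.1 y ≤ q.2.2 + v y := by
  refine convexHull_min ?_ (convex_setOf_pairing_le y v (v y)) hq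
  rintro ⟨z, u, c⟩ ⟨hu, rfl : c = u z⟩
  have := hT (z, u) hu (y, v) hv
  simp only [sub_apply, map_sub, Set.mem_ofPred_eq] at *
  linarith

/-- `pairing_le` compares `q` with graph points. For fixed `q` that comparison is affine in the
graph point, so it extends to the hull and can be applied to `q` itself. -/
theorem IsMonotone.coupling_le {T : X → Set (StrongDual ℝ X)} (hT : IsMonotone T)
    {q : X × StrongDual ℝ X × ℝ} (hq : q ∈ couplingHull T) : q.2.1 q.1 ≤ q.2.2 := by
  have h : q ∈ {p : X × StrongDual ℝ X × ℝ | q.2.1 p.1 + p.2.1 q.1 ≤ p.2.2 + q.2.2} := by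
    refine convexHull_min ?_ (convex_setOf_pairing_le q.1 q.2.1 q.2.2) hq
    rintro ⟨z, u, c⟩ ⟨hu, rfl : c = u z⟩
    have := hT.pairing_le hq hu
    simp only [Set.mem_ofPred_eq] at *
    linarith
  simp only [Set.mem_ofPred_eq] at h
  linarith

theorem norm_le_of_mem_couplingHull {T : X → Set (StrongDual ℝ X)} {M : ℝ}
    (hM : ∀ u ∈ range T, ‖u‖ ≤ M) {q : X × StrongDual ℝ X × ℝ} (hq : q ∈ couplingHull T) :
    ‖q.2.1‖ ≤ M := by
  have hc : Convex ℝ {p : X × StrongDual ℝ X × ℝ | ‖p.2.1‖ ≤ M} := by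
    intro p hp r hr a b ha hb hab
    have := convex_closedBall (0 : StrongDual ℝ X) M (mem_closedBall_zero_iff.2 hp)
      (mem_closedBall_zero_iff.2 hr) ha hb hab
    simpa using this
  refine convexHull_min ?_ hc hq
  rintro ⟨z, u, c⟩ ⟨hu, -⟩
  exact hM u ⟨z, hu⟩

/-! ### Sums with bounded operators -/

/-- A bounded maximal monotone operator is defined everywhere. -/
theorem IsMaximalMonotone.mem_domain_of_bounded {S : X → Set (StrongDual ℝ X)}
    (hS : IsMaximalMonotone S) {M : ℝ} (hM0 : 0 ≤ M) (hM : ∀ u ∈ range S, ‖u‖ ≤ M) (x : X) :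
    x ∈ domain S := by
  -- Encodes `w (y - x) ≤ v (y - x)` for `v ∈ S y`: that `(x, w)` is monotonically related to `S`.
  let C : Set (X × ℝ) := (fun q : X × StrongDual ℝ X × ℝ => (q.1 - x, q.2.2 - q.2.1 x)) ''
    couplingHull S
  have hC : Convex ℝ C := by
    rintro _ ⟨p, hp, rfl⟩ _ ⟨q, hq, rfl⟩ a b ha hb hab
    refine ⟨a • p + b • q, convex_couplingHull S hp hq ha hb hab, Prod.ext ?_ ?_⟩
    · have : x = a • x + b • x := by rw [← add_smul, hab, one_smul]
      simp only [Prod.fst_add, Prod.smul_fst]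
      nth_rw 1 [this]
      module
    · simp
      ring
  obtain ⟨w, -, hw⟩ := exists_norm_le_forall_apply_le hC hM0 (by
    rintro _ ⟨q, hq, rfl⟩
    have h₁ := hS.1.coupling_le hq
    have h₂ := (abs_le.1 (q.2.1.le_of_opNorm_le (norm_le_of_mem_couplingHull hM hq)
      (q.1 - x))).1
    rw [map_sub] at h₂
    dsimp only
    linarith)
  refine ⟨w, hS.mem_of_related fun y v hv => ?_⟩
  have := hw _ ⟨_, mem_couplingHull hv, rfl⟩
  simp only [sub_apply, map_sub] at *
  linarith

/-- If the first components of all pairs monotonically related to `T + S` lie in the domain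
of `T`, and `S` is bounded, then `T + S` is maximal monotone. -/
theorem IsMaximalMonotone.opAdd_of_bounded {T S : X → Set (StrongDual ℝ X)}
    (hT : IsMaximalMonotone T) (hS : IsMaximalMonotone S) (hSb : IsBoundedOp S)
    (hdom : ∀ x u, (∀ y, ∀ v ∈ opAdd T S y, 0 ≤ (v - u) (y - x)) → x ∈ domain T) :
    IsMaximalMonotone (opAdd T S) := by
  obtain ⟨M, hM0, hM⟩ := hSb.exists_pos_norm_le
  have hSdom := hS.mem_domain_of_bounded hM0.le hM
  -- No pair is strictly related to all of `T + S`: its first component would lie in both domains,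
  -- and testing there gives `0 > 0`.
  have hNI : ∀ x u, ∃ y, ∃ v ∈ opAdd T S y, (v - u) (y - x) ≤ 0 := by
    intro x u
    by_contra! hcon
    obtain ⟨a, ha⟩ := hdom x u fun y v hv => (hcon y v hv).le
    obtain ⟨b, hb⟩ := hSdom x
    simpa using hcon x (a + b) (Set.add_mem_add ha hb)
  refine (hT.1.opAdd hS.1).isMaximalMonotone fun x u hxu => ?_
  -- The sum of the conditions for `w ∈ T x` and `u - w ∈ S x`, arranged as a bound on `w (y - z)`.
  let C : Set (X × ℝ) := (fun q : (X × StrongDual ℝ X × ℝ) × (X × StrongDual ℝ X × ℝ) =>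
    (q.1.1 - q.2.1, q.1.2.2 - q.1.2.1 x + q.2.2.2 - q.2.2.1 x - u (q.2.1 - x))) ''
    (couplingHull T ×ˢ couplingHull S)
  have hC : Convex ℝ C := by
    rintro _ ⟨p, hp, rfl⟩ _ ⟨q, hq, rfl⟩ a b ha hb hab
    refine ⟨a • p + b • q, ((convex_couplingHull T).prod (convex_couplingHull S)) hp hq ha hb hab,
      Prod.ext ?_ ?_⟩
    · simp only [Prod.fst_add, Prod.smul_fst, Prod.snd_add, Prod.smul_snd]
      module
    · simp only [Prod.fst_add, Prod.smul_fst, Prod.snd_add, Prod.smul_snd, map_add, map_sub,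
        map_smul, add_apply, smul_apply, smul_eq_mul]
      linear_combination (-u x) * hab
  obtain ⟨w, -, hw⟩ := exists_norm_le_forall_apply_le (M := M + ‖u‖) hC (by positivity) (by
    rintro _ ⟨⟨p, q⟩, ⟨hp, hq⟩, rfl⟩
    dsimp only at hp hq ⊢
    by_contra! hneg
    set η := -(p.2.2 - p.2.1 x + q.2.2 - q.2.1 x - u (q.1 - x) + (M + ‖u‖) * ‖p.1 - q.1‖)
      with hη
    have hη0 : 0 < η := by linarith
    -- The radius `M + ‖u‖` pays for replacing `q.1` by `p.1`, since `‖s - u‖ ≤ M + ‖u‖`.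
    have hbound : ∀ y, ∀ r ∈ opAdd T S y,
        (r - u) (p.1 - x) + (p.2.1 + q.2.1 - u) (y - x) - (r - u) (y - x) ≤ -η := by
      rintro y _ ⟨v, hv, s, hs, rfl⟩
      have h₁ := hT.1.pairing_le hp hv
      have h₂ := hS.1.pairing_le hq hs
      have h₃ : ‖s - u‖ ≤ M + ‖u‖ :=
        (norm_sub_le _ _).trans (add_le_add_left (hM s ⟨y, hs⟩) _)
      have h₄ := (abs_le.1 ((s - u).le_of_opNorm_le h₃ (p.1 - q.1))).2
      simp only [sub_apply, add_apply, map_sub] at *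
      linarith
    set c := (p.2.1 + q.2.1 - u) (p.1 - x) with hc
    -- If `η + t * c > 0`, moving `(x, u)` by a fraction `t` towards `(p.1, p.2.1 + q.2.1)` gives a
    -- strictly related pair, against `hNI`.
    have hsmall : ∀ t : ℝ, t ∈ Set.Ioo (0 : ℝ) 1 → η + t * c ≤ 0 := by
      intro t ht
      obtain ⟨y, r, hr, hyr⟩ := hNI (x + t • (p.1 - x)) (u + t • (p.2.1 + q.2.1 - u))
      have h₁ := hbound y r hr
      have h₂ := hxu y r hr
      have h₃ : (r - (u + t • (p.2.1 + q.2.1 - u))) (y - (x + t • (p.1 - x))) =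
          (r - u) (y - x) - t * (r - u) (p.1 - x) - t * (p.2.1 + q.2.1 - u) (y - x)
            + t ^ 2 * c := by
        rw [hc]
        simp only [sub_apply, add_apply,
          smul_apply, map_sub, map_add, map_smul, smul_eq_mul]
        ring
      rw [h₃] at hyr
      have h₄ := mul_le_mul_of_nonneg_left h₁ ht.1.le
      have h₅ := mul_nonneg (sub_nonneg.2 ht.2.le) h₂
      by_contra! hpos
      have := mul_pos ht.1 hpos
      nlinarith
    have hlim : Filter.Tendsto (fun t : ℝ => η + t * c) (nhdsWithin 0 (Set.Ioi 0))
        (nhds (η + 0 * c)) :=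
      ((by fun_prop : Continuous fun t : ℝ => η + t * c).tendsto 0).mono_left nhdsWithin_le_nhds
    have := le_of_tendsto hlim (Filter.mem_of_superset (Ioo_mem_nhdsGT one_pos) hsmall)
    linarith)
  have hrel : ∀ y, ∀ v ∈ T y, ∀ z, ∀ s ∈ S z,
      0 ≤ (v - w) (y - x) + (s - (u - w)) (z - x) := by
    intro y v hv z s hs
    have := hw _ ⟨(_, _), ⟨mem_couplingHull hv, mem_couplingHull hs⟩, rfl⟩
    simp only [sub_apply, map_sub] at *
    linarith
  -- Taking one of the two graph points over `x` itself kills its term in `hrel` and decouples the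
  -- conditions.
  obtain ⟨a, ha⟩ := hdom x u hxu
  obtain ⟨b, hb⟩ := hSdom x
  refine ⟨w, hT.mem_of_related fun y v hv => ?_, u - w, hS.mem_of_related fun z s hs => ?_,
    add_sub_cancel _ _⟩
  · simpa using hrel y v hv x b hb
  · simpa using hrel x a ha z s hs

/-! ### The slope supremum -/

theorem slopeSup_le_ofReal_iff {x : X} {u : StrongDual ℝ X} {T : X → Set (StrongDual ℝ X)}
    {c : ℝ} (hc : 0 ≤ c) :
    slopeSup x u T ≤ ENNReal.ofReal c ↔ ∀ y, ∀ v ∈ T y, (v - u) (x - y) ≤ c * ‖x - y‖ := by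
  simp only [slopeSup, iSup_le_iff, Prod.forall, ENNReal.ofReal_le_ofReal_iff hc]
  refine forall_congr' fun y => forall_congr' fun v => forall_congr' fun hv => ?_
  rcases eq_or_ne y x with rfl | hy
  · simp
  · have : 0 < ‖x - y‖ := norm_pos_iff.2 (sub_ne_zero.2 hy.symm)
    simp [hy, div_le_iff₀ this]

/-- For `a ∈ T x`, monotonicity gives `(v - u) (x - y) ≤ (a - u) (x - y) ≤ ‖a - u‖ * ‖x - y‖`. -/
theorem IsMonotone.slopeSup_le_infEDist {T : X → Set (StrongDual ℝ X)} (hT : IsMonotone T)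
    (x : X) (u : StrongDual ℝ X) : slopeSup x u T ≤ Metric.infEDist u (T x) := by
  refine Metric.le_infEDist.2 fun a ha => ?_
  rw [edist_dist]
  refine (slopeSup_le_ofReal_iff dist_nonneg).2 fun y v hv => ?_
  have h₁ := hT (x, a) ha (y, v) hv
  have h₂ := (a - u).le_opNorm (x - y)
  have h₃ := (abs_le.1 h₂).2
  rw [← dist_eq_norm, dist_comm] at h₃
  simp only [sub_apply] at *
  linarith

/-- The slope supremum at `x` equals the distance to `T x` when the sums of `T` with the
subdifferentials of the multiples of the distance to `x` are maximal monotone. -/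
theorem slopeSup_eq_infEDist_of_opAdd {T : X → Set (StrongDual ℝ X)} (hT : IsMonotone T) {x : X}
    (h : ∀ c : ℝ, 0 < c → IsMaximalMonotone (opAdd T (subdifferential (normFun c x))))
    (u : StrongDual ℝ X) : slopeSup x u T = Metric.infEDist u (T x) := by
  refine (hT.slopeSup_le_infEDist x u).antisymm (le_of_forall_gt fun b hb => ?_)
  obtain ⟨c, hc, hcb⟩ := ENNReal.lt_iff_exists_nnreal_btwn.1 hb
  have hc0 : (0 : ℝ) < c := by
    rcases eq_or_ne c 0 with rfl | hne
    · simp at hc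
    · positivity
  have hrel := (slopeSup_le_ofReal_iff hc0.le).1 (hc.le.trans_eq ENNReal.ofReal_coe_nnreal.symm)
  -- The gain `s (y - x) ≥ c * ‖x - y‖` offsets the slope bound `c`.
  obtain ⟨a, ha, s, hs, hsum⟩ := (h c hc0).mem_of_related (x := x) (u := u) (by
    rintro y _ ⟨v, hv, s, hs, rfl⟩
    have h₁ := hrel y v hv
    have h₂ := apply_of_mem_subdifferential_normFun hs
    simp only [sub_apply, add_apply, map_sub] at *
    linarith)
  refine (Metric.infEDist_le_edist_of_mem ha).trans_lt (lt_of_le_of_lt ?_ hcb)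
  have hus : dist u a = ‖s‖ := by
    rw [dist_eq_norm, ← hsum]
    simp
  rw [edist_dist, hus, ← ENNReal.ofReal_coe_nnreal]
  exact ENNReal.ofReal_le_ofReal (norm_le_of_mem_subdifferential_normFun hc0.le hs)

/-- Points monotonically related to the sum of `T` and a bounded everywhere defined operator have
finite slope supremum. -/
theorem slopeSup_zero_lt_top {T S : X → Set (StrongDual ℝ X)} {M : ℝ} (hM0 : 0 ≤ M)
    (hM : ∀ u ∈ range S, ‖u‖ ≤ M) (hS : ∀ x, x ∈ domain S) {x : X} {u : StrongDual ℝ X}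
    (h : ∀ y, ∀ v ∈ opAdd T S y, 0 ≤ (v - u) (y - x)) : slopeSup x 0 T < ∞ := by
  refine lt_of_le_of_lt ((slopeSup_le_ofReal_iff (c := M + ‖u‖) (by positivity)).2 ?_)
    ENNReal.ofReal_lt_top
  intro y v hv
  obtain ⟨s, hs⟩ := hS y
  have h₁ := h y _ (Set.add_mem_add hv hs)
  have h₂ : ‖s - u‖ ≤ M + ‖u‖ := (norm_sub_le _ _).trans (add_le_add_left (hM s ⟨y, hs⟩) _)
  have h₃ := (abs_le.1 ((s - u).le_of_opNorm_le h₂ (x - y))).1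
  simp only [sub_apply, add_apply, map_sub,
    sub_zero] at *
  linarith

end Aux

end RegularMonotone

theorem theorem2p3 {X : Type*} [NormedAddCommGroup X] [NormedSpace ℝ X] [CompleteSpace X]
    (T : X → Set (StrongDual ℝ X)) (hT : RegularMonotone.IsMaximalMonotone T) :
    List.TFAE [
      ∀ (x : X) (u : StrongDual ℝ X),
        RegularMonotone.slopeSup x u T = Metric.infEDist u (T x),
      ∀ S : X → Set (StrongDual ℝ X),
        RegularMonotone.IsMaximalMonotone S → RegularMonotone.IsBoundedOp S →
          RegularMonotone.IsMaximalMonotone (RegularMonotone.opAdd T S),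
      ∀ (c : ℝ) (x : X), 0 < c →
        RegularMonotone.IsMaximalMonotone
          (RegularMonotone.opAdd T
            (RegularMonotone.subdifferential (RegularMonotone.normFun c x))),
      ∀ x : X, RegularMonotone.slopeSup x 0 T < ∞ → x ∈ RegularMonotone.domain T,
      ∀ x : X, RegularMonotone.slopeSup x 0 T = Metric.infEDist 0 (T x)] := by
  tfae_have 1 → 5 := fun h x => h x 0
  tfae_have 5 → 4 := fun h x hx => by
    rw [h x] at hx
    by_contra hne
    rw [Set.not_nonempty_iff_eq_empty.1 hne, Metric.infEDist_empty] at hx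
    exact lt_irrefl _ hx
  tfae_have 4 → 2 := fun h S hS hSb => by
    obtain ⟨M, hM0, hM⟩ := hSb.exists_pos_norm_le
    exact hT.opAdd_of_bounded hS hSb fun x u hxu =>
      h x (RegularMonotone.slopeSup_zero_lt_top hM0.le hM (hS.mem_domain_of_bounded hM0.le hM) hxu)
  tfae_have 2 → 3 := fun h c x hc =>
    h _ (RegularMonotone.subdifferential_normFun_isMaximalMonotone hc.le x)
      (RegularMonotone.subdifferential_normFun_isBoundedOp hc.le x)
  tfae_have 3 → 1 := fun h x u =>
    RegularMonotone.slopeSup_eq_infEDist_of_opAdd hT.1 (fun c hc => h c x hc) u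
  tfae_finish
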